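/- Let $d\ge 1$ and let $a_k:=\frac{k}{d}(1,\dots,1)\in\mathbb{R}^d$ for $k\in\mathbb{Z}$. Put $$V(x):=\sum_{k\in\mathbb{Z}}\frac{1}{|x-a_k|^2},\qquad x\in\mathbb{R}^d\setminus\{a_k : k\in\mathbb{Z}\},$$ where $|\cdot|$ is the Euclidean norm. For $R>0$ let $\mathcal{C}_R\subset\mathbb{R}^d$ be the open cylinder of radius $R$ around the line $x_1=x_2=\dots=x_d$, i.e. the set of points whose distance to this line is less than $R$, and let $$\mu(\mathcal{C}_R):=\inf_{u\in C_0^\infty(\mathcal{C}_R\setminus\{a_k : k\in\mathbb{Z}\}),\ u\ne 0}\ \frac{\int_{\mathcal{C}_R}|\nabla u|^2\,dx}{\int_{\mathcal{C}_R}V u^2\,dx},$$ where $C_0^\infty(\Omega)$ is the space of smooth real-valued functions with compact support in $\Omega$. (i) For every $R>0$, $$\frac{(d-2)^2}{4\pi R\sqrt{d}\,\coth(\pi R\sqrt{d})}\le\mu(\mathcal{C}_R)\le\frac{(d-2)^2}{4}.$$ (ii) Consequently, $\displaystyle\lim_{R\searrow 0}\mu(\mathcal{C}_R)=\frac{(d-2)^2}{4}$.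 -/

import Mathlib

open Set Filter Topology MeasureTheory
open scoped ContDiff

noncomputable section

/-- The pole `a_k = (k h, …, k h)` in `ℝ^d`. -/
def hardyPole (d : ℕ) (h : ℝ) (k : ℤ) : EuclideanSpace ℝ (Fin d) :=
  WithLp.toLp 2 fun _ => (k : ℝ) * h

/-- The potential `V(x) = ∑_{k ∈ ℤ} 1 / |x - a_k|²`. The series converges at every point that is
not a pole; its values at the (countably many) poles play no role. -/
def hardyPotential (d : ℕ) (h : ℝ) (x : EuclideanSpace ℝ (Fin d)) : ℝ :=
  ∑' k : ℤ, 1 / ‖x - hardyPole d h k‖ ^ 2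

/-- The line `x_1 = x_2 = ⋯ = x_d`. -/
def diagonalAxis (d : ℕ) : Set (EuclideanSpace ℝ (Fin d)) :=
  {x | ∃ t : ℝ, ∀ i, x i = t}

/-- The (open) right circular cylinder of radius `R` around the line `x_1 = ⋯ = x_d`. -/
def hardyCylinder (d : ℕ) (R : ℝ) : Set (EuclideanSpace ℝ (Fin d)) :=
  {x | Metric.infDist x (diagonalAxis d) < R}

/-- Smooth real functions with compact support contained in `Ω`, extended by zero to the whole
space. -/
def IsTestFunction {d : ℕ} (Ω : Set (EuclideanSpace ℝ (Fin d)))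
    (u : EuclideanSpace ℝ (Fin d) → ℝ) : Prop :=
  ContDiff ℝ ∞ u ∧ HasCompactSupport u ∧ tsupport u ⊆ Ω

/-- The values of the Hardy quotient `∫ |∇u|² / ∫ V u²` over the cylinder, where `u ≠ 0` runs
through the test functions on the cylinder without the poles. -/
def hardyQuotients (d : ℕ) (h R : ℝ) : Set ℝ :=
  {q | ∃ u : EuclideanSpace ℝ (Fin d) → ℝ,
    IsTestFunction (hardyCylinder d R \ ⋃ k : ℤ, {hardyPole d h k}) u ∧ u ≠ 0 ∧
    q = (∫ x in hardyCylinder d R, ‖gradient u x‖ ^ 2) /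
      (∫ x in hardyCylinder d R, hardyPotential d h x * u x ^ 2)}

/-- The Hardy constant `μ(C_R)`. -/
def hardyConstant (d : ℕ) (h R : ℝ) : ℝ :=
  sInf (hardyQuotients d h R)

/-- The hyperbolic cotangent. -/
def realCoth (x : ℝ) : ℝ :=
  Real.cosh x / Real.sinh x

end

/-!
Let `s = x₁ + ⋯ + x_d` and let `q = d |x|² - s²`, which is `d` times the squared distance to the
axis. Then `d |x - a_k|² = (s - k)² + q`, so the Mittag-Leffler expansion of the cotangent sums the
potential in closed form (`hardyPotential_eq`): with `ψ(t) = cosh √t`, an entire function, and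
`t = 4π²q`,
`V = 4π²d ψ'(t) / W`, where `W = ψ(t) - cos (2πs)`.
The function `W` is smooth on all of space and vanishes exactly at the poles. Working with `ψ`
instead of `cosh` and `sinh` of the distance to the axis avoids any singularity on the axis.

*Lower bound.* For every real `a`, expanding `|∇u + a u ∇W / W|² ≥ 0` and integrating by parts gives
`∫ |∇u|² ≥ ∫ (a ΔW / W - (a + a²) |∇W|² / W²) u²`
(`integral_weight_le_integral_norm_gradient_sq`). Here
`ΔW = 4π²d (2(d-2) ψ' + ψ + cos (2πs))` and `|∇W|² = 4π²d (ψ + cos (2πs)) W`, so that the weight is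
`4π²d (2a(d-2) ψ' - a² (ψ + cos (2πs))) / W`. Since `x coth x` is nondecreasing, on the cylinder
`ψ + cos (2πs) ≤ ψ + 1 ≤ 4 T ψ'` with `T = πR√d coth (πR√d)` (`coshSqrt_add_one_le`), and the
weight is at least `(2a(d-2) - 4a²T) V`. The best choice `a = (d-2) / (4T)` gives the constant
`(d-2)² / (4T)`.

*Upper bound.* As `V ≥ 1 / |x|²`, test functions `u(x) = |x|^κ g (log |x|)` with `κ = -(d-2)/2` and
`g` supported far to the left have, by polar coordinates, a quotient of at most
`∫ (g' + κ g)² / ∫ g² = κ² + ∫ g'² / ∫ g²` (`exists_hardyQuotient_le`); stretching `g` makes the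
last term arbitrarily small. This covers all `d ≥ 1`, including `d = 2`.

The limit follows by squeezing, as `x coth x → 1` when `x → 0`.
-/

noncomputable section

/-! ### The function `cosh √t` -/

/-- The entire function `t ↦ ∑ tⁿ / (2n)!`, that is, `t ↦ cosh √t` continued to all real `t`. -/
def coshSqrt (t : ℝ) : ℝ :=
  FormalMultilinearSeries.ofScalarsSum (fun n : ℕ => (((2 * n).factorial : ℝ))⁻¹) t

theorem coshSqrt_sq (x : ℝ) : coshSqrt (x ^ 2) = Real.cosh x := by
  rw [coshSqrt, FormalMultilinearSeries.ofScalars_sum_eq, ← (Real.hasSum_cosh x).tsum_eq]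
  refine tsum_congr fun n => ?_
  rw [smul_eq_mul, ← pow_mul, div_eq_inv_mul]

theorem contDiff_coshSqrt : ContDiff ℝ ∞ coshSqrt := by
  have hr : (FormalMultilinearSeries.ofScalars ℝ
      (fun n : ℕ => (((2 * n).factorial : ℝ))⁻¹)).radius = ⊤ := by
    refine FormalMultilinearSeries.ofScalars_radius_eq_top_of_tendsto ℝ _
      (Eventually.of_forall fun n => by positivity) ?_
    have h : ∀ n : ℕ, ‖(((2 * n.succ).factorial : ℝ))⁻¹‖ / ‖(((2 * n).factorial : ℝ))⁻¹‖
        = 1 / (((2 * n + 1 : ℕ) : ℝ) + 1) * (1 / (2 * (n : ℝ) + 1)) := by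
      intro n
      have : (2 * n.succ).factorial = (2 * n + 2) * ((2 * n + 1) * (2 * n).factorial) := by
        rw [show 2 * n.succ = 2 * n + 1 + 1 by omega, Nat.factorial_succ, Nat.factorial_succ]
      have h0 : ((2 * n).factorial : ℝ) ≠ 0 := by positivity
      rw [this, norm_inv, norm_inv]
      simp only [Real.norm_natCast]
      push_cast
      field_simp
      ring
    simp_rw [h]
    refine squeeze_zero (fun n => by positivity) (fun n => ?_) tendsto_one_div_add_atTop_nhds_zero_nat
    calc 1 / (((2 * n + 1 : ℕ) : ℝ) + 1) * (1 / (2 * (n : ℝ) + 1))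
        ≤ 1 / ((n : ℝ) + 1) * 1 := by
          gcongr
          · linarith [(Nat.cast_nonneg n : (0 : ℝ) ≤ n)]
          · rw [div_le_one (by positivity)]; linarith [(Nat.cast_nonneg n : (0 : ℝ) ≤ n)]
      _ = _ := mul_one _
  have hf := FormalMultilinearSeries.hasFPowerSeriesOnBall (𝕜 := ℝ) (E := ℝ) (F := ℝ)
    (FormalMultilinearSeries.ofScalars ℝ (fun n : ℕ => (((2 * n).factorial : ℝ))⁻¹))
    (by rw [hr]; exact ENNReal.coe_lt_top)
  rw [hr] at hf
  have : AnalyticOnNhd ℝ coshSqrt univ := by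
    have := hf.analyticOnNhd
    rwa [Metric.eball_top] at this
  exact this.contDiff

theorem two_mul_deriv_coshSqrt_sq (x : ℝ) : 2 * x * deriv coshSqrt (x ^ 2) = Real.sinh x := by
  have h1 : HasDerivAt (fun y : ℝ => coshSqrt (y ^ 2)) (deriv coshSqrt (x ^ 2) * (2 * x)) x := by
    have := ((contDiff_coshSqrt.differentiable (by simp)) (x ^ 2)).hasDerivAt.comp x
      (hasDerivAt_pow 2 x)
    simpa [Function.comp_def] using this
  rw [funext coshSqrt_sq] at h1
  rw [← h1.unique (Real.hasDerivAt_cosh x)]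
  ring

theorem contDiff_deriv_coshSqrt : ContDiff ℝ ∞ (deriv coshSqrt) :=
  (contDiff_infty_iff_deriv.1 contDiff_coshSqrt).2

/-- The differential equation `2 ψ' + 4 t ψ'' = ψ` of `ψ(t) = cosh √t`, for `t ≥ 0`. -/
theorem coshSqrt_ode {t : ℝ} (ht : 0 ≤ t) :
    2 * deriv coshSqrt t + 4 * t * deriv (deriv coshSqrt) t = coshSqrt t := by
  obtain ⟨x, rfl⟩ : ∃ x : ℝ, t = x ^ 2 := ⟨√t, (Real.sq_sqrt ht).symm⟩
  have h1 : HasDerivAt (fun y : ℝ => 2 * y * deriv coshSqrt (y ^ 2))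
      (2 * 1 * deriv coshSqrt (x ^ 2) + 2 * x * (deriv (deriv coshSqrt) (x ^ 2) * (2 * x))) x := by
    have := ((contDiff_deriv_coshSqrt.differentiable (by simp)) (x ^ 2)).hasDerivAt.comp x
      (hasDerivAt_pow 2 x)
    exact ((hasDerivAt_id x).const_mul 2).mul (by simpa [Function.comp_def] using this)
  rw [funext two_mul_deriv_coshSqrt_sq] at h1
  rw [coshSqrt_sq, ← h1.unique (Real.hasDerivAt_sinh x)]
  ring

/-- `cosh² - sinh² = 1` in terms of `ψ(t) = cosh √t`. -/
theorem four_mul_deriv_coshSqrt_sq {t : ℝ} (ht : 0 ≤ t) :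
    4 * t * deriv coshSqrt t ^ 2 = coshSqrt t ^ 2 - 1 := by
  obtain ⟨x, rfl⟩ : ∃ x : ℝ, t = x ^ 2 := ⟨√t, (Real.sq_sqrt ht).symm⟩
  have := two_mul_deriv_coshSqrt_sq x
  rw [coshSqrt_sq, Real.cosh_sq, ← this]
  ring

theorem deriv_coshSqrt_zero : deriv coshSqrt 0 = 1 / 2 := by
  have h := coshSqrt_ode le_rfl
  have h2 := coshSqrt_sq 0
  norm_num at h h2
  linarith

theorem deriv_coshSqrt_pos {t : ℝ} (ht : 0 ≤ t) : 0 < deriv coshSqrt t := by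
  rcases ht.eq_or_lt with rfl | ht
  · rw [deriv_coshSqrt_zero]; norm_num
  · have h := two_mul_deriv_coshSqrt_sq (√t)
    have hs : 0 < √t := Real.sqrt_pos.2 ht
    rw [Real.sq_sqrt ht.le] at h
    have h3 : 0 < 2 * √t * deriv coshSqrt t := h ▸ Real.sinh_pos_iff.2 hs
    exact pos_of_mul_pos_right h3 (by positivity)

theorem one_le_coshSqrt {t : ℝ} (ht : 0 ≤ t) : 1 ≤ coshSqrt t := by
  rw [← Real.sq_sqrt ht, coshSqrt_sq]; exact Real.one_le_cosh _

theorem one_lt_coshSqrt {t : ℝ} (ht : 0 < t) : 1 < coshSqrt t := by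
  rw [← Real.sq_sqrt ht.le, coshSqrt_sq]; exact Real.one_lt_cosh.2 (Real.sqrt_pos.2 ht).ne'

/-! ### Monotonicity of `x coth x` -/

/-- `x ↦ x coth x` is nondecreasing on `(0, ∞)`: by the addition formulas this says that
`(y + x) sinh (y - x) ≤ (y - x) sinh (y + x)`, an instance of the convexity of `sinh`. -/
theorem mul_cosh_mul_sinh_le {x y : ℝ} (hx : 0 ≤ x) (hxy : x ≤ y) :
    x * Real.cosh x * Real.sinh y ≤ y * Real.cosh y * Real.sinh x := by
  have key : ∀ p q : ℝ, 0 ≤ p → p ≤ q → q * Real.sinh p ≤ p * Real.sinh q := by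
    intro p q hp hpq
    have hm : MonotoneOn (fun q => p * Real.sinh q - q * Real.sinh p) (Ici p) := by
      refine monotoneOn_of_deriv_nonneg (convex_Ici p) (by fun_prop) (by fun_prop) fun y hy => ?_
      rw [interior_Ici] at hy
      have hd : HasDerivAt (fun q => p * Real.sinh q - q * Real.sinh p)
          (p * Real.cosh y - 1 * Real.sinh p) y :=
        ((Real.hasDerivAt_sinh y).const_mul p).sub ((hasDerivAt_id y).mul_const _)
      rw [hd.deriv]
      have h1 : Real.cosh p ≤ Real.cosh y := by
        rw [Real.cosh_le_cosh, abs_of_nonneg hp, abs_of_nonneg (hp.trans (le_of_lt hy))]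
        exact le_of_lt hy
      have h2 : Real.sinh p ≤ p * Real.cosh p := by
        have hm : MonotoneOn (fun q => q * Real.cosh q - Real.sinh q) (Ici 0) := by
          refine monotoneOn_of_deriv_nonneg (convex_Ici 0) (by fun_prop) (by fun_prop)
            fun y hy => ?_
          rw [interior_Ici] at hy
          have hd : HasDerivAt (fun q => q * Real.cosh q - Real.sinh q)
              (1 * Real.cosh y + y * Real.sinh y - Real.cosh y) y :=
            ((hasDerivAt_id y).mul (Real.hasDerivAt_cosh y)).sub (Real.hasDerivAt_sinh y)
          rw [hd.deriv]
          have : 0 ≤ y * Real.sinh y := mul_nonneg (le_of_lt hy) (Real.sinh_nonneg_iff.2 (le_of_lt hy))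
          linarith
        have := hm (mem_Ici.2 le_rfl) (mem_Ici.2 hp) hp
        simp only [zero_mul, Real.sinh_zero, sub_zero] at this
        linarith
      nlinarith [mul_le_mul_of_nonneg_left h1 hp]
    have := hm (mem_Ici.2 le_rfl) (mem_Ici.2 hpq) hpq
    simp only [sub_self] at this
    linarith
  have h := key (y - x) (y + x) (by linarith) (by linarith)
  rw [Real.sinh_add, Real.sinh_sub] at h
  nlinarith

theorem one_le_mul_realCoth {y : ℝ} (hy : 0 < y) : 1 ≤ y * realCoth y := by
  have hs := Real.sinh_pos_iff.2 hy
  rw [realCoth, ← mul_div_assoc, one_le_div hs]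
  -- compare the values of `x coth x` at `y` and at `x → 0`
  have hlim : Tendsto (fun x : ℝ => y * Real.cosh y * (2 * deriv coshSqrt (x ^ 2))
      - Real.cosh x * Real.sinh y) (𝓝[>] 0) (𝓝 (y * Real.cosh y - Real.sinh y)) := by
    have hc : Continuous (fun x : ℝ => y * Real.cosh y * (2 * deriv coshSqrt (x ^ 2))
      - Real.cosh x * Real.sinh y) := by
      have := contDiff_deriv_coshSqrt.continuous
      fun_prop
    have := (hc.tendsto 0).mono_left (nhdsWithin_le_nhds (s := Ioi 0))
    simpa [deriv_coshSqrt_zero] using this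
  refine sub_nonneg.1 (ge_of_tendsto hlim ?_)
  filter_upwards [Ioc_mem_nhdsGT hy] with x hx
  have h := mul_cosh_mul_sinh_le hx.1.le hx.2
  rw [← two_mul_deriv_coshSqrt_sq x] at h
  refine sub_nonneg.2 (le_of_mul_le_mul_left ?_ hx.1)
  linarith

/-- The bound `cosh ω + 1 ≤ (2 sinh ω / ω) T` with `T = y coth y` for `ω = 2x`, `0 ≤ x ≤ y`. -/
theorem coshSqrt_add_one_le {x y : ℝ} (hx : 0 ≤ x) (hxy : x ≤ y) (hy : 0 < y) :
    coshSqrt ((2 * x) ^ 2) + 1 ≤ 4 * deriv coshSqrt ((2 * x) ^ 2) * (y * realCoth y) := by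
  rcases hx.eq_or_lt with rfl | hx
  · have := one_le_mul_realCoth hy
    have h2 := coshSqrt_sq 0
    norm_num [deriv_coshSqrt_zero] at h2 ⊢
    rw [h2]
    linarith
  · have h := mul_cosh_mul_sinh_le hx.le hxy
    have hs := Real.sinh_pos_iff.2 hy
    have h1 := two_mul_deriv_coshSqrt_sq (2 * x)
    rw [Real.sinh_two_mul] at h1
    have h2 : deriv coshSqrt ((2 * x) ^ 2) = Real.sinh x * Real.cosh x / (2 * x) := by
      rw [eq_div_iff (by positivity)]; linarith
    have hc := Real.cosh_pos x
    rw [coshSqrt_sq, h2, Real.cosh_two_mul, realCoth]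
    have h3 : Real.cosh x ^ 2 + Real.sinh x ^ 2 + 1 = 2 * Real.cosh x ^ 2 := by
      rw [Real.cosh_sq]; ring
    rw [h3, show 4 * (Real.sinh x * Real.cosh x / (2 * x)) * (y * (Real.cosh y / Real.sinh y))
      = 2 * Real.cosh x * (y * Real.cosh y * Real.sinh x) / (x * Real.sinh y) by
        field_simp; ring, le_div_iff₀ (by positivity)]
    nlinarith [mul_le_mul_of_nonneg_left h hc.le]

theorem tendsto_mul_realCoth : Tendsto (fun y : ℝ => y * realCoth y) (𝓝[>] 0) (𝓝 1) := by
  have hc : ContinuousAt (fun x : ℝ => Real.cosh x / (2 * deriv coshSqrt (x ^ 2))) 0 := by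
    have := contDiff_deriv_coshSqrt.continuous
    refine ContinuousAt.div (by fun_prop) (by fun_prop) ?_
    simp [deriv_coshSqrt_zero]
  have h := hc.tendsto.mono_left (nhdsWithin_le_nhds (s := Ioi 0))
  norm_num [deriv_coshSqrt_zero] at h
  refine h.congr' ?_
  filter_upwards [self_mem_nhdsWithin] with x hx
  have hx : 0 < x := hx
  have hp := deriv_coshSqrt_pos (sq_nonneg x)
  rw [realCoth, ← two_mul_deriv_coshSqrt_sq x]
  field_simp

/-! ### The series `∑ 1 / ((a - k)² + q)` -/

/-- The imaginary part of the Mittag-Leffler expansion of `π cot (π w)` at `w = a + i r`. -/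
theorem hasSum_one_div_sub_int_sq_add_sq (a : ℝ) {r : ℝ} (hr : 0 < r) :
    HasSum (fun k : ℤ => 1 / ((a - k) ^ 2 + r ^ 2))
      (Real.pi / r * (Real.sinh (2 * Real.pi * r) /
        (Real.cosh (2 * Real.pi * r) - Real.cos (2 * Real.pi * a)))) := by
  set w : ℂ := ⟨a, r⟩ with hw
  have hwZ : w ∈ Complex.integerComplement := by
    rintro ⟨n, hn⟩
    have := congrArg Complex.im hn
    simp [hw] at this
    exact hr.ne this
  have h1 : HasSum (fun n : ℕ => cotTerm w n) (Real.pi * Complex.cot (Real.pi * w) - 1 / w) := by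
    rw [cot_series_rep' hwZ]
    exact (summable_cotTerm hwZ).hasSum
  have h2 := (Complex.hasSum_im h1).mul_left (-1 / r)
  have him : ∀ c : ℝ, (1 / (w - c)).im = -r / ((a - c) ^ 2 + r ^ 2) := by
    intro c
    rw [one_div, Complex.inv_im]
    simp [hw, Complex.normSq_apply]
    ring
  have hterm : ∀ n : ℕ, -1 / r * (cotTerm w n).im =
      1 / ((a - ((n : ℤ) + 1 : ℤ)) ^ 2 + r ^ 2) + 1 / ((a - (-((n : ℤ) + 1) : ℤ)) ^ 2 + r ^ 2) := by
    intro n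
    have e1 := him ((n : ℝ) + 1)
    have e2 := him (-((n : ℝ) + 1))
    push_cast at e1 e2 ⊢
    rw [sub_neg_eq_add] at e2
    rw [cotTerm, Complex.add_im, e1, e2, mul_add]
    congr 1 <;> field_simp
  rw [funext hterm] at h2
  set f : ℤ → ℝ := fun k => 1 / ((a - k) ^ 2 + r ^ 2) with hf
  have hf0 : ∀ k, 0 ≤ f k := fun k => by positivity
  have hA : Summable fun n : ℕ => f ((n : ℤ) + 1) :=
    Summable.of_nonneg_of_le (fun n => hf0 _) (fun n => le_add_of_nonneg_right (hf0 _)) h2.summable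
  have hB : Summable fun n : ℕ => f (-((n : ℤ) + 1)) :=
    Summable.of_nonneg_of_le (fun n => hf0 _) (fun n => le_add_of_nonneg_left (hf0 _)) h2.summable
  have h3 := HasSum.of_add_one_of_neg_add_one hA.hasSum hB.hasSum
  have h4 := (hA.hasSum.add hB.hasSum).unique h2
  convert h3 using 1
  rw [add_right_comm, h4, Complex.sub_im]
  have h5 := him 0
  simp only [Complex.ofReal_zero, sub_zero] at h5
  have hx : (Real.pi : ℂ) * w = (Real.pi * a : ℝ) + (Real.pi * r : ℝ) * Complex.I := by
    apply Complex.ext <;> simp [hw]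
  have h6 : (Real.pi * Complex.cot (Real.pi * w)).im = -Real.pi * (Real.sinh (2 * Real.pi * r) /
        (Real.cosh (2 * Real.pi * r) - Real.cos (2 * Real.pi * a))) := by
    rw [Complex.im_ofReal_mul, Complex.cot, hx, Complex.cos_add_mul_I, Complex.sin_add_mul_I,
      ← Complex.ofReal_cos, ← Complex.ofReal_sin, ← Complex.ofReal_cosh, ← Complex.ofReal_sinh,
      mul_assoc 2, mul_assoc 2, Real.sinh_two_mul, Real.cosh_two_mul, Real.cos_two_mul]
    set x := Real.pi * a
    set y := Real.pi * r with hy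
    have hy0 : 0 < Real.sinh y := Real.sinh_pos_iff.2 (by positivity)
    have hsc := Real.sin_sq_add_cos_sq x
    have hch := Real.cosh_sq y
    rw [Complex.div_im]
    simp only [Complex.normSq_apply, Complex.add_re, Complex.sub_re, Complex.add_im,
      Complex.sub_im, Complex.mul_re, Complex.mul_im, Complex.ofReal_re, Complex.ofReal_im,
      Complex.I_re, Complex.I_im]
    have hD1 : 0 < Real.sinh y ^ 2 + Real.sin x ^ 2 := by positivity
    have hN : (Real.sin x * Real.cosh y) ^ 2 + (Real.cos x * Real.sinh y) ^ 2
        = Real.sinh y ^ 2 + Real.sin x ^ 2 := by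
      rw [mul_pow, mul_pow, hch]; linear_combination Real.sinh y ^ 2 * hsc
    have hD : Real.cosh y ^ 2 + Real.sinh y ^ 2 - (2 * Real.cos x ^ 2 - 1)
        = 2 * (Real.sinh y ^ 2 + Real.sin x ^ 2) := by
      rw [hch]; linear_combination -2 * hsc
    simp only [mul_zero, zero_mul, add_zero, sub_zero, zero_add, mul_one, zero_sub]
    rw [hD, ← sq, ← sq, hN]
    field_simp
    linear_combination -hsc
  rw [h6, h5, hf]
  field_simp
  simp
  ring

/-- The sum `∑ 1 / ((a - k)² + q)` in closed form; the case `q = 0` is the limit `q → 0`. -/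
theorem hasSum_one_div_sub_int_sq_add (a : ℝ) {q : ℝ} (hq : 0 ≤ q)
    (h : q = 0 → ∀ k : ℤ, a ≠ k) :
    HasSum (fun k : ℤ => 1 / ((a - k) ^ 2 + q))
      (4 * Real.pi ^ 2 * deriv coshSqrt (4 * Real.pi ^ 2 * q) /
        (coshSqrt (4 * Real.pi ^ 2 * q) - Real.cos (2 * Real.pi * a))) := by
  have hpos : ∀ q : ℝ, 0 < q → HasSum (fun k : ℤ => 1 / ((a - k) ^ 2 + q))
      (4 * Real.pi ^ 2 * deriv coshSqrt (4 * Real.pi ^ 2 * q) /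
        (coshSqrt (4 * Real.pi ^ 2 * q) - Real.cos (2 * Real.pi * a))) := by
    intro q hq
    have hr := Real.sqrt_pos.2 hq
    have h1 := hasSum_one_div_sub_int_sq_add_sq a hr
    have h2 : (2 * Real.pi * √q) ^ 2 = 4 * Real.pi ^ 2 * q := by
      rw [mul_pow, Real.sq_sqrt hq.le]; ring
    rw [← two_mul_deriv_coshSqrt_sq, ← coshSqrt_sq, h2, Real.sq_sqrt hq.le] at h1
    convert h1 using 1
    field_simp
    ring
  rcases hq.eq_or_lt with rfl | hq
  swap
  · exact hpos q hq
  have hak : ∀ k : ℤ, 0 < (a - k) ^ 2 := fun k => by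
    have := sub_ne_zero.2 (h rfl k)
    positivity
  have hcos : Real.cos (2 * Real.pi * a) < 1 := by
    refine lt_of_le_of_ne (Real.cos_le_one _) fun hc => ?_
    obtain ⟨k, hk⟩ := (Real.cos_eq_one_iff _).1 hc
    refine h rfl k (mul_left_cancel₀ Real.two_pi_pos.ne' ?_)
    linarith
  -- summability at `q = 0`: all but finitely many terms are at most twice those with `q = 1`
  have hsum : Summable fun k : ℤ => 1 / (a - k) ^ 2 := by
    refine Summable.of_norm_bounded_eventually ((hpos 1 one_pos).summable.mul_left 2) ?_
    have hfin : {k : ℤ | ¬ 1 ≤ (a - k) ^ 2}.Finite := by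
      refine (Set.finite_Icc (⌊a⌋ - 1) (⌈a⌉ + 1)).subset fun k hk => ?_
      have hk : (a - k) ^ 2 < 1 := not_le.1 hk
      have h1 := abs_lt.1 ((sq_lt_one_iff_abs_lt_one _).1 hk)
      have h2 := Int.floor_le a
      have h3 := Int.le_ceil a
      constructor
      · have : ((⌊a⌋ - 1 : ℤ) : ℝ) ≤ k := by push_cast; linarith
        exact_mod_cast this
      · have : (k : ℝ) ≤ ((⌈a⌉ + 1 : ℤ) : ℝ) := by push_cast; linarith
        exact_mod_cast this
    filter_upwards [hfin.compl_mem_cofinite] with k hk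
    have hk : 1 ≤ (a - k) ^ 2 := not_not.1 hk
    rw [Real.norm_of_nonneg (by positivity), ← mul_one_div, mul_one_div, mul_one_div,
      div_le_div_iff₀ (hak k) (by positivity)]
    linarith
  have hlim : Tendsto (fun q : ℝ => ∑' k : ℤ, 1 / ((a - k) ^ 2 + q)) (𝓝[>] 0)
      (𝓝 (∑' k : ℤ, 1 / ((a - k) ^ 2 + 0))) := by
    refine tendsto_tsum_of_dominated_convergence hsum (fun k => ?_) ?_
    · have : ContinuousAt (fun q : ℝ => 1 / ((a - k) ^ 2 + q)) 0 :=
        ContinuousAt.div (by fun_prop) (by fun_prop) (by simpa using (hak k).ne')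
      exact this.tendsto.mono_left nhdsWithin_le_nhds
    · filter_upwards [self_mem_nhdsWithin] with q hq k
      have hq : 0 < q := hq
      rw [Real.norm_of_nonneg (by positivity)]
      exact one_div_le_one_div_of_le (hak k) (by linarith)
  have hlim2 : Tendsto (fun q : ℝ => 4 * Real.pi ^ 2 * deriv coshSqrt (4 * Real.pi ^ 2 * q) /
        (coshSqrt (4 * Real.pi ^ 2 * q) - Real.cos (2 * Real.pi * a))) (𝓝[>] 0)
      (𝓝 (4 * Real.pi ^ 2 * deriv coshSqrt (4 * Real.pi ^ 2 * 0) /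
        (coshSqrt (4 * Real.pi ^ 2 * 0) - Real.cos (2 * Real.pi * a)))) := by
    have c1 := contDiff_deriv_coshSqrt.continuous
    have c2 := contDiff_coshSqrt.continuous
    have : ContinuousAt (fun q : ℝ => 4 * Real.pi ^ 2 * deriv coshSqrt (4 * Real.pi ^ 2 * q) /
        (coshSqrt (4 * Real.pi ^ 2 * q) - Real.cos (2 * Real.pi * a))) 0 := by
      refine ContinuousAt.div (by fun_prop) (by fun_prop) ?_
      have := one_le_coshSqrt (t := 4 * Real.pi ^ 2 * 0) (by simp)
      linarith
    exact this.tendsto.mono_left nhdsWithin_le_nhds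
  rw [← tendsto_nhds_unique hlim (hlim2.congr' ?_)]
  · simpa using hsum.hasSum
  · filter_upwards [self_mem_nhdsWithin] with q hq using (hpos q hq).tsum_eq.symm

/-! ### A Hardy inequality from a positive function -/

theorem contDiff_div_of_tsupport_subset {E : Type*} [NormedAddCommGroup E] [NormedSpace ℝ E]
    {n : WithTop ℕ∞} {f W : E → ℝ} (hf : ContDiff ℝ n f) (hW : ContDiff ℝ n W)
    (h : tsupport f ⊆ {x | W x ≠ 0}) : ContDiff ℝ n fun x => f x / W x := by
  refine contDiff_iff_contDiffAt.2 fun x => ?_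
  by_cases hx : x ∈ tsupport f
  · exact hf.contDiffAt.div hW.contDiffAt (h hx)
  · refine (contDiffAt_const (c := (0 : ℝ))).congr_of_eventuallyEq ?_
    filter_upwards [notMem_tsupport_iff_eventuallyEq.1 hx] with y hy
    simp [hy]

theorem norm_gradient_sq_eq_sum {d : ℕ} (u : EuclideanSpace ℝ (Fin d) → ℝ)
    (x : EuclideanSpace ℝ (Fin d)) :
    ‖gradient u x‖ ^ 2 = ∑ i, fderiv ℝ u x (EuclideanSpace.single i 1) ^ 2 := by
  rw [EuclideanSpace.real_norm_sq_eq]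
  refine Finset.sum_congr rfl fun i _ => ?_
  rw [← toDual_gradient, InnerProductSpace.toDual_apply_apply, EuclideanSpace.inner_single_right]
  simp

/-- A Hardy inequality with the weight produced by the supersolution `W⁻ᵃ`: expand
`|∇u + a u ∇W / W|² ≥ 0` and integrate the cross term `2 u ∇u · ∇W / W` by parts. -/
theorem integral_weight_le_integral_norm_gradient_sq {d : ℕ} {u W : EuclideanSpace ℝ (Fin d) → ℝ}
    (hu : ContDiff ℝ ∞ u) (hc : HasCompactSupport u) (hW : ContDiff ℝ ∞ W)
    (hs : tsupport u ⊆ {x | W x ≠ 0}) (a : ℝ) :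
    Integrable (fun x => (a * ∑ i, fderiv ℝ (fun y => fderiv ℝ W y (EuclideanSpace.single i 1)) x
        (EuclideanSpace.single i 1) - (a + a ^ 2) * (∑ i, fderiv ℝ W x
          (EuclideanSpace.single i 1) ^ 2) / W x) * (u x ^ 2 / W x)) ∧
    ∫ x, (a * ∑ i, fderiv ℝ (fun y => fderiv ℝ W y (EuclideanSpace.single i 1)) x
        (EuclideanSpace.single i 1) - (a + a ^ 2) * (∑ i, fderiv ℝ W x
          (EuclideanSpace.single i 1) ^ 2) / W x) * (u x ^ 2 / W x)
      ≤ ∫ x, ‖gradient u x‖ ^ 2 := by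
  set e : Fin d → EuclideanSpace ℝ (Fin d) := fun i => EuclideanSpace.single i 1 with he
  have hsq : tsupport (fun x => u x ^ 2) ⊆ tsupport u := by
    refine closure_mono fun x hx hux => hx ?_
    simp [hux]
  set v : EuclideanSpace ℝ (Fin d) → ℝ := fun x => u x ^ 2 / W x with hv
  have hvs : ContDiff ℝ ∞ v := contDiff_div_of_tsupport_subset (hu.pow 2) hW (hsq.trans hs)
  have hvu : Function.support v ⊆ Function.support u := by
    intro x hx hux
    exact hx (by simp [hv, hux])
  have hvc : HasCompactSupport v := hc.mono hvu
  have hvt : tsupport v ⊆ tsupport u := closure_mono hvu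
  have huv : ∀ x, v x * W x = u x ^ 2 := fun x => by
    by_cases hx : x ∈ tsupport u
    · exact div_mul_cancel₀ _ (hs hx)
    · simp [hv, image_eq_zero_of_notMem_tsupport hx]
  have hww : ContDiff ℝ ∞ fun x => v x / W x :=
    contDiff_div_of_tsupport_subset hvs hW (hvt.trans hs)
  have hdiff : ∀ {f : EuclideanSpace ℝ (Fin d) → ℝ}, ContDiff ℝ ∞ f → ∀ i,
      ContDiff ℝ ∞ fun x => fderiv ℝ f x (e i) := fun hf i =>
    (hf.fderiv_right (m := ∞) (by simp)).clm_apply contDiff_const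
  have hdc : ∀ {f : EuclideanSpace ℝ (Fin d) → ℝ}, HasCompactSupport f → ∀ i,
      HasCompactSupport fun x => fderiv ℝ f x (e i) := fun hf i =>
    (hf.fderiv (𝕜 := ℝ)).comp_left (g := fun L : _ →L[ℝ] ℝ => L (e i)) (by simp)
  have hd1 : ∀ {f : EuclideanSpace ℝ (Fin d) → ℝ}, ContDiff ℝ ∞ f → ∀ x,
    DifferentiableAt ℝ f x := fun hf x => hf.differentiable (by simp) x
  -- integrability of the continuous, compactly supported terms
  have i1 : ∀ i, Integrable fun x => v x * fderiv ℝ (fun y => fderiv ℝ W y (e i)) x (e i) :=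
    fun i => (hvs.continuous.mul (hdiff (hdiff hW i) i).continuous).integrable_of_hasCompactSupport
      hvc.mul_right
  have i2 : ∀ i, Integrable fun x => fderiv ℝ v x (e i) * fderiv ℝ W x (e i) :=
    fun i => ((hdiff hvs i).continuous.mul (hdiff hW i).continuous).integrable_of_hasCompactSupport
      (hdc hvc i).mul_right
  have i3 : ∀ i, Integrable fun x => v x * fderiv ℝ W x (e i) :=
    fun i => (hvs.continuous.mul (hdiff hW i).continuous).integrable_of_hasCompactSupport
      hvc.mul_right
  have i4 : ∀ i, Integrable fun x => fderiv ℝ u x (e i) ^ 2 := fun i => by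
    refine ((hdiff hu i).continuous.pow 2).integrable_of_hasCompactSupport ?_
    simpa only [pow_two] using (hdc hc i).mul_left
  have i5 : ∀ i, Integrable fun x => (v x / W x) * fderiv ℝ W x (e i) ^ 2 := fun i => by
    refine (hww.continuous.mul ((hdiff hW i).continuous.pow 2)).integrable_of_hasCompactSupport
      (HasCompactSupport.mul_right (hvc.mono fun x hx hvx => hx ?_))
    simp [hvx]
  have ibp : ∀ i, ∫ x, v x * fderiv ℝ (fun y => fderiv ℝ W y (e i)) x (e i)
      = -∫ x, fderiv ℝ v x (e i) * fderiv ℝ W x (e i) := fun i =>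
    integral_mul_fderiv_eq_neg_fderiv_mul_of_integrable (i2 i) (i1 i) (i3 i)
      (fun x _ => hd1 hvs x) (fun x _ => hd1 (hdiff hW i) x)
  have hterm : ∀ i, 0 ≤ (∫ x, fderiv ℝ u x (e i) ^ 2)
      - a * (∫ x, v x * fderiv ℝ (fun y => fderiv ℝ W y (e i)) x (e i))
      + (a + a ^ 2) * ∫ x, (v x / W x) * fderiv ℝ W x (e i) ^ 2 := by
    intro i
    have i6 : Integrable fun x => fderiv ℝ u x (e i) ^ 2
        + a * (fderiv ℝ v x (e i) * fderiv ℝ W x (e i)) := (i4 i).add ((i2 i).const_mul _)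
    rw [ibp, mul_neg, sub_neg_eq_add, ← integral_const_mul, ← integral_const_mul,
      ← integral_add (i4 i) ((i2 i).const_mul _), ← integral_add i6 ((i5 i).const_mul _)]
    refine integral_nonneg fun x => ?_
    by_cases hx : x ∈ tsupport u
    · have hWx : W x ≠ 0 := hs hx
      have hdv : fderiv ℝ v x (e i) = 2 * u x * fderiv ℝ u x (e i) / W x
          - u x ^ 2 * fderiv ℝ W x (e i) / W x ^ 2 := by
        have h1 := (hd1 hu x).hasFDerivAt.pow 2
        have h2 := (hd1 hvs x).hasFDerivAt.mul (hd1 hW x).hasFDerivAt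
        rw [show v * W = u ^ 2 from funext fun y => huv y] at h2
        have h3 := congrArg (fun L : _ →L[ℝ] ℝ => L (e i)) (h2.unique h1)
        simp only [add_apply, smul_apply, smul_eq_mul,
          nsmul_eq_mul, hv] at h3
        field_simp at h3 ⊢
        push_cast at h3
        linear_combination h3
      have : fderiv ℝ u x (e i) ^ 2 + a * (fderiv ℝ v x (e i) * fderiv ℝ W x (e i))
          + (a + a ^ 2) * (v x / W x * fderiv ℝ W x (e i) ^ 2)
          = (fderiv ℝ u x (e i) + a * u x * fderiv ℝ W x (e i) / W x) ^ 2 := by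
        rw [hdv, hv]
        field_simp
        ring
      simp only [Pi.zero_apply, this]
      positivity
    · have h1 : fderiv ℝ u x = 0 := image_eq_zero_of_notMem_tsupport
        fun h => hx (tsupport_fderiv_subset ℝ h)
      have h2 : fderiv ℝ v x = 0 := image_eq_zero_of_notMem_tsupport
        fun h => hx (hvt (tsupport_fderiv_subset ℝ h))
      have h3 : v x = 0 := image_eq_zero_of_notMem_tsupport fun h => hx (hvt h)
      simp [h1, h2, h3]
  have hsum := Finset.sum_nonneg fun i (_ : i ∈ Finset.univ) => hterm i
  rw [Finset.sum_add_distrib, Finset.sum_sub_distrib, ← Finset.mul_sum, ← Finset.mul_sum,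
    ← integral_finsetSum _ (fun i _ => i1 i), ← integral_finsetSum _ (fun i _ => i4 i),
    ← integral_finsetSum _ (fun i _ => i5 i)] at hsum
  simp_rw [norm_gradient_sq_eq_sum]
  have hI : Integrable fun x => (a * ∑ i, fderiv ℝ (fun y => fderiv ℝ W y (e i)) x (e i)
      - (a + a ^ 2) * (∑ i, fderiv ℝ W x (e i) ^ 2) / W x) * v x := by
    refine (((integrable_finsetSum Finset.univ fun i _ => i1 i).const_mul a).sub
      ((integrable_finsetSum Finset.univ fun i _ => i5 i).const_mul (a + a ^ 2))).congr
      (Eventually.of_forall fun x => ?_)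
    simp only [Pi.sub_apply, ← Finset.mul_sum]
    ring
  refine ⟨hI, ?_⟩
  have : ∫ x, (a * ∑ i, fderiv ℝ (fun y => fderiv ℝ W y (e i)) x (e i)
      - (a + a ^ 2) * (∑ i, fderiv ℝ W x (e i) ^ 2) / W x) * v x
      = a * (∫ x, ∑ i, v x * fderiv ℝ (fun y => fderiv ℝ W y (e i)) x (e i))
      - (a + a ^ 2) * ∫ x, ∑ i, (v x / W x) * fderiv ℝ W x (e i) ^ 2 := by
    rw [← integral_const_mul, ← integral_const_mul, ← integral_sub
      ((integrable_finsetSum _ fun i _ => i1 i).const_mul _)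
      ((integrable_finsetSum _ fun i _ => i5 i).const_mul _)]
    refine integral_congr_ae (Eventually.of_forall fun x => ?_)
    simp only [← Finset.mul_sum]
    ring
  rw [this]
  linarith

/-! ### Geometry of the poles and closed form of the potential -/

/-- The linear functional `x ↦ x₁ + ⋯ + x_d`. -/
def coordSum (d : ℕ) : EuclideanSpace ℝ (Fin d) →L[ℝ] ℝ :=
  ∑ i, EuclideanSpace.proj i

theorem coordSum_apply {d : ℕ} (x : EuclideanSpace ℝ (Fin d)) : coordSum d x = ∑ i, x i := by
  simp [coordSum]

theorem coordSum_single {d : ℕ} (i : Fin d) :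
    coordSum d (EuclideanSpace.single i 1) = 1 := by
  rw [coordSum_apply]; simp

/-- `d` times the squared distance of `x` to the diagonal. -/
def axisDistSq (d : ℕ) (x : EuclideanSpace ℝ (Fin d)) : ℝ :=
  d * ‖x‖ ^ 2 - coordSum d x ^ 2

/-- The distance of `x` to a point of the diagonal, by Pythagoras. -/
theorem card_mul_norm_sub_sq {d : ℕ} (hd : 1 ≤ d) (x : EuclideanSpace ℝ (Fin d))
    {p : EuclideanSpace ℝ (Fin d)} {t : ℝ} (hp : ∀ i, p i = t / d) :
    d * ‖x - p‖ ^ 2 = (coordSum d x - t) ^ 2 + axisDistSq d x := by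
  have hd0 : (d : ℝ) ≠ 0 := by positivity
  have h : ‖x - p‖ ^ 2 = ‖x‖ ^ 2 - 2 * (t / d) * coordSum d x + d * (t / d) ^ 2 := by
    rw [EuclideanSpace.real_norm_sq_eq, EuclideanSpace.real_norm_sq_eq, coordSum_apply]
    simp only [PiLp.sub_apply, hp, sub_sq, Finset.sum_add_distrib, Finset.sum_sub_distrib,
      Finset.mul_sum, Finset.sum_const, Finset.card_univ, Fintype.card_fin, nsmul_eq_mul]
    congr 2
    exact Finset.sum_congr rfl fun i _ => by ring
  rw [h, axisDistSq]
  field_simp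
  ring

theorem axisDistSq_nonneg {d : ℕ} (hd : 1 ≤ d) (x : EuclideanSpace ℝ (Fin d)) :
    0 ≤ axisDistSq d x := by
  have h := card_mul_norm_sub_sq hd x (p := WithLp.toLp 2 fun _ => coordSum d x / d)
    (t := coordSum d x) (fun i => rfl)
  rw [sub_self] at h
  have : 0 ≤ (d : ℝ) * ‖x - WithLp.toLp 2 fun _ => coordSum d x / d‖ ^ 2 := by positivity
  linarith

theorem axisDistSq_le_of_mem_hardyCylinder {d : ℕ} (hd : 1 ≤ d) {R : ℝ}
    {x : EuclideanSpace ℝ (Fin d)} (hx : x ∈ hardyCylinder d R) : axisDistSq d x ≤ d * R ^ 2 := by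
  have hd0 : (d : ℝ) ≠ 0 := by positivity
  have hne : (diagonalAxis d).Nonempty := ⟨0, 0, fun i => rfl⟩
  obtain ⟨p, ⟨t, ht⟩, hp⟩ := (Metric.infDist_lt_iff hne).1 hx
  have h := card_mul_norm_sub_sq hd x (p := p) (t := d * t)
    (fun i => by rw [ht, mul_div_cancel_left₀ _ hd0])
  rw [dist_eq_norm] at hp
  have : (d : ℝ) * ‖x - p‖ ^ 2 ≤ d * R ^ 2 := by gcongr
  nlinarith [sq_nonneg (coordSum d x - d * t)]

/-- The function `cosh (2π√d r) - cos (2π√d z)` of the distance `r` to the diagonal and the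
coordinate `z` along it; it is positive except for double zeros at the poles. -/
def poleFunction (d : ℕ) (x : EuclideanSpace ℝ (Fin d)) : ℝ :=
  coshSqrt (4 * Real.pi ^ 2 * axisDistSq d x) - Real.cos (2 * Real.pi * coordSum d x)

theorem contDiff_axisDistSq (d : ℕ) : ContDiff ℝ ∞ (axisDistSq d) :=
  (contDiff_const.mul (contDiff_norm_sq ℝ)).sub ((coordSum d).contDiff.pow 2)

theorem contDiff_poleFunction (d : ℕ) : ContDiff ℝ ∞ (poleFunction d) :=
  (contDiff_coshSqrt.comp (contDiff_const.mul (contDiff_axisDistSq d))).sub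
    (Real.contDiff_cos.comp (contDiff_const.mul (coordSum d).contDiff))

theorem coordSum_ne_intCast {d : ℕ} (hd : 1 ≤ d) {x : EuclideanSpace ℝ (Fin d)}
    (hx : x ∉ ⋃ k : ℤ, {hardyPole d (1 / d) k}) (h0 : axisDistSq d x = 0) (k : ℤ) :
    coordSum d x ≠ k := by
  intro hk
  refine hx (mem_iUnion.2 ⟨k, mem_singleton_iff.2 (sub_eq_zero.1 ?_)⟩)
  have h := card_mul_norm_sub_sq hd x (p := hardyPole d (1 / d) k) (t := k)
    (fun i => by simp [hardyPole, div_eq_mul_inv])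
  rw [h0, hk, sub_self] at h
  have hd0 : (d : ℝ) ≠ 0 := by positivity
  simpa [hd0] using h

theorem poleFunction_pos {d : ℕ} (hd : 1 ≤ d) {x : EuclideanSpace ℝ (Fin d)}
    (hx : x ∉ ⋃ k : ℤ, {hardyPole d (1 / d) k}) : 0 < poleFunction d x := by
  rw [poleFunction, sub_pos]
  rcases (axisDistSq_nonneg hd x).eq_or_lt with h0 | h0
  · have h1 := one_le_coshSqrt (t := 4 * Real.pi ^ 2 * axisDistSq d x) (by rw [← h0]; simp)
    refine lt_of_lt_of_le (lt_of_le_of_ne (Real.cos_le_one _) fun hc => ?_) h1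
    obtain ⟨k, hk⟩ := (Real.cos_eq_one_iff _).1 hc
    refine coordSum_ne_intCast hd hx h0.symm k (mul_left_cancel₀ Real.two_pi_pos.ne' ?_)
    linarith
  · exact (Real.cos_le_one _).trans_lt (one_lt_coshSqrt (by positivity))

theorem hasSum_hardyPotential {d : ℕ} (hd : 1 ≤ d) {x : EuclideanSpace ℝ (Fin d)}
    (hx : x ∉ ⋃ k : ℤ, {hardyPole d (1 / d) k}) :
    HasSum (fun k : ℤ => 1 / ‖x - hardyPole d (1 / d) k‖ ^ 2)
      (4 * Real.pi ^ 2 * d * deriv coshSqrt (4 * Real.pi ^ 2 * axisDistSq d x) /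
        poleFunction d x) := by
  have hd0 : (d : ℝ) ≠ 0 := by positivity
  have h := (hasSum_one_div_sub_int_sq_add (coordSum d x) (axisDistSq_nonneg hd x)
    (coordSum_ne_intCast hd hx)).mul_left (d : ℝ)
  have hterm : ∀ k : ℤ, 1 / ‖x - hardyPole d (1 / d) k‖ ^ 2
      = d * (1 / ((coordSum d x - k) ^ 2 + axisDistSq d x)) := fun k => by
    rw [← card_mul_norm_sub_sq hd x (p := hardyPole d (1 / d) k) (t := k)
      (fun i => by simp [hardyPole, div_eq_mul_inv]), mul_one_div, div_mul_cancel_left₀ hd0,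
      one_div]
  rw [funext hterm]
  have e : 4 * Real.pi ^ 2 * d * deriv coshSqrt (4 * Real.pi ^ 2 * axisDistSq d x) /
      poleFunction d x = d * (4 * Real.pi ^ 2 * deriv coshSqrt (4 * Real.pi ^ 2 * axisDistSq d x) /
        (coshSqrt (4 * Real.pi ^ 2 * axisDistSq d x)
          - Real.cos (2 * Real.pi * coordSum d x))) := by
    simp only [poleFunction]
    ring
  rw [e]
  exact h

theorem hardyPotential_eq {d : ℕ} (hd : 1 ≤ d) {x : EuclideanSpace ℝ (Fin d)}
    (hx : x ∉ ⋃ k : ℤ, {hardyPole d (1 / d) k}) :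
    hardyPotential d (1 / d) x =
      4 * Real.pi ^ 2 * d * deriv coshSqrt (4 * Real.pi ^ 2 * axisDistSq d x) /
        poleFunction d x :=
  (hasSum_hardyPotential hd hx).tsum_eq

/-! ### Derivatives of the pole function -/

theorem hasFDerivAt_axisDistSq {d : ℕ} (x : EuclideanSpace ℝ (Fin d)) :
    HasFDerivAt (axisDistSq d)
      ((d : ℝ) • (2 • innerSL ℝ x) - (2 * coordSum d x) • coordSum d) x := by
  have h := ((hasStrictFDerivAt_norm_sq x).hasFDerivAt.const_mul (d : ℝ)).sub
    ((coordSum d).hasFDerivAt.pow 2 (x := x))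
  have h' : HasFDerivAt (axisDistSq d) _ x := h
  exact h'.congr_fderiv (by simp)

theorem fderiv_poleFunction_single {d : ℕ} (x : EuclideanSpace ℝ (Fin d)) (i : Fin d) :
    fderiv ℝ (poleFunction d) x (EuclideanSpace.single i 1) =
      4 * Real.pi ^ 2 * deriv coshSqrt (4 * Real.pi ^ 2 * axisDistSq d x) *
        (2 * (d * x i - coordSum d x)) + 2 * Real.pi * Real.sin (2 * Real.pi * coordSum d x) := by
  have h1 := ((contDiff_coshSqrt.differentiable (by simp)) _).hasDerivAt.comp_hasFDerivAt x
    ((hasFDerivAt_axisDistSq x).const_mul (4 * Real.pi ^ 2))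
  have h2 := (Real.hasDerivAt_cos _).comp_hasFDerivAt x
    ((coordSum d).hasFDerivAt.const_mul (2 * Real.pi))
  have h : HasFDerivAt (poleFunction d) _ x := h1.sub h2
  rw [h.fderiv]
  simp [coordSum_single, EuclideanSpace.inner_single_right]
  ring

theorem fderiv_fderiv_poleFunction_single {d : ℕ} (x : EuclideanSpace ℝ (Fin d)) (i : Fin d) :
    fderiv ℝ (fun y => fderiv ℝ (poleFunction d) y (EuclideanSpace.single i 1)) x
        (EuclideanSpace.single i 1) =
      16 * Real.pi ^ 4 * deriv (deriv coshSqrt) (4 * Real.pi ^ 2 * axisDistSq d x) *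
        (2 * (d * x i - coordSum d x)) ^ 2
      + 4 * Real.pi ^ 2 * deriv coshSqrt (4 * Real.pi ^ 2 * axisDistSq d x) * (2 * (d - 1))
      + 4 * Real.pi ^ 2 * Real.cos (2 * Real.pi * coordSum d x) := by
  simp_rw [fderiv_poleFunction_single]
  have h1 := ((contDiff_deriv_coshSqrt.differentiable (by simp)) _).hasDerivAt.comp_hasFDerivAt x
    ((hasFDerivAt_axisDistSq x).const_mul (4 * Real.pi ^ 2))
  have h2 := (Real.hasDerivAt_sin _).comp_hasFDerivAt x
    ((coordSum d).hasFDerivAt.const_mul (2 * Real.pi))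
  have h3 : HasFDerivAt (fun y : EuclideanSpace ℝ (Fin d) => 2 * (d * y i - coordSum d y)) _ x :=
    (((EuclideanSpace.proj i : EuclideanSpace ℝ (Fin d) →L[ℝ] ℝ).hasFDerivAt.const_mul
      (d : ℝ)).sub (coordSum d).hasFDerivAt).const_mul 2
  have h := ((h1.const_mul (4 * Real.pi ^ 2)).mul h3).add (h2.const_mul (2 * Real.pi))
  have h' : HasFDerivAt (fun x : EuclideanSpace ℝ (Fin d) =>
    4 * Real.pi ^ 2 * deriv coshSqrt (4 * Real.pi ^ 2 * axisDistSq d x) *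
        (2 * (d * x i - coordSum d x)) + 2 * Real.pi * Real.sin (2 * Real.pi * coordSum d x))
    _ x := h
  rw [h'.fderiv]
  simp [coordSum_single, EuclideanSpace.inner_single_right]
  ring

theorem sum_sq_card_mul_sub_coordSum {d : ℕ} (x : EuclideanSpace ℝ (Fin d)) :
    ∑ i, (2 * (d * x i - coordSum d x)) ^ 2 = 4 * d * axisDistSq d x := by
  have h : ∀ i, (2 * (d * x i - coordSum d x)) ^ 2
    = 4 * d ^ 2 * x i ^ 2 - 8 * d * coordSum d x * x i + 4 * coordSum d x ^ 2 := fun i => by ring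
  simp_rw [h, Finset.sum_add_distrib, Finset.sum_sub_distrib, ← Finset.mul_sum, ← coordSum_apply,
    ← EuclideanSpace.real_norm_sq_eq]
  simp [axisDistSq]
  ring

theorem laplacian_poleFunction {d : ℕ} (hd : 1 ≤ d) (x : EuclideanSpace ℝ (Fin d)) :
    ∑ i, fderiv ℝ (fun y => fderiv ℝ (poleFunction d) y (EuclideanSpace.single i 1)) x
        (EuclideanSpace.single i 1) =
      4 * Real.pi ^ 2 * d * (2 * (d - 2) * deriv coshSqrt (4 * Real.pi ^ 2 * axisDistSq d x)
        + coshSqrt (4 * Real.pi ^ 2 * axisDistSq d x)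
        + Real.cos (2 * Real.pi * coordSum d x)) := by
  have hq := axisDistSq_nonneg hd x
  simp_rw [fderiv_fderiv_poleFunction_single, Finset.sum_add_distrib, ← Finset.mul_sum,
    sum_sq_card_mul_sub_coordSum,
    ← coshSqrt_ode (t := 4 * Real.pi ^ 2 * axisDistSq d x) (by positivity)]
  simp
  ring

theorem sum_fderiv_poleFunction_sq {d : ℕ} (hd : 1 ≤ d) (x : EuclideanSpace ℝ (Fin d)) :
    ∑ i, fderiv ℝ (poleFunction d) x (EuclideanSpace.single i 1) ^ 2 =
      4 * Real.pi ^ 2 * d * (coshSqrt (4 * Real.pi ^ 2 * axisDistSq d x)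
        + Real.cos (2 * Real.pi * coordSum d x)) * poleFunction d x := by
  have hq := axisDistSq_nonneg hd x
  have h0 : ∑ i, (2 * (d * x i - coordSum d x)) = 0 := by
    rw [← Finset.mul_sum, Finset.sum_sub_distrib, ← Finset.mul_sum, ← coordSum_apply]
    simp
  have h1 := four_mul_deriv_coshSqrt_sq (t := 4 * Real.pi ^ 2 * axisDistSq d x) (by positivity)
  have h2 := Real.sin_sq_add_cos_sq (2 * Real.pi * coordSum d x)
  simp_rw [fderiv_poleFunction_single]
  generalize hA : deriv coshSqrt (4 * Real.pi ^ 2 * axisDistSq d x) = A at *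
  generalize hS : Real.sin (2 * Real.pi * coordSum d x) = S at *
  have h3 : ∀ i : Fin d, (4 * Real.pi ^ 2 * A * (2 * (d * x i - coordSum d x))
      + 2 * Real.pi * S) ^ 2 = (4 * Real.pi ^ 2 * A) ^ 2 * (2 * (d * x i - coordSum d x)) ^ 2
      + 16 * Real.pi ^ 3 * A * S * (2 * (d * x i - coordSum d x))
      + 4 * Real.pi ^ 2 * S ^ 2 := fun i => by ring
  rw [Finset.sum_congr rfl fun i _ => h3 i, Finset.sum_add_distrib, Finset.sum_add_distrib,
    ← Finset.mul_sum, ← Finset.mul_sum, sum_sq_card_mul_sub_coordSum, h0]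
  simp only [poleFunction, Finset.sum_const, Finset.card_univ, Fintype.card_fin, nsmul_eq_mul]
  linear_combination 4 * Real.pi ^ 2 * d * h1 + 4 * Real.pi ^ 2 * d * h2


/-! ### The lower bound on the cylinder -/

/-- The pointwise bound behind the lower estimate, for `a = (d - 2) / (4T)`, `T = πR√d coth (πR√d)`:
the optimal choice of `a`. -/
theorem le_weight_poleFunction {d : ℕ} (hd : 1 ≤ d) {R : ℝ} (hR : 0 < R)
    {x : EuclideanSpace ℝ (Fin d)} (hx : x ∈ hardyCylinder d R)
    (hW : 0 < poleFunction d x) {T a : ℝ}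
    (hT : T = Real.pi * R * √d * realCoth (Real.pi * R * √d)) (ha : a = (d - 2) / (4 * T)) :
    ((d : ℝ) - 2) ^ 2 / (4 * T) *
        (4 * Real.pi ^ 2 * d * deriv coshSqrt (4 * Real.pi ^ 2 * axisDistSq d x)) ≤
      a * ∑ i, fderiv ℝ (fun y => fderiv ℝ (poleFunction d) y (EuclideanSpace.single i 1)) x
        (EuclideanSpace.single i 1) - (a + a ^ 2) * (∑ i, fderiv ℝ (poleFunction d) x
          (EuclideanSpace.single i 1) ^ 2) / poleFunction d x := by
  have hd0 : (0 : ℝ) < d := by positivity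
  have hq := axisDistSq_nonneg hd x
  have hy : 0 < Real.pi * R * √d := by positivity
  have hTpos : 0 < T := by rw [hT]; linarith [one_le_mul_realCoth hy]
  have hxy : Real.pi * √(axisDistSq d x) ≤ Real.pi * R * √d := by
    rw [mul_assoc]
    refine mul_le_mul_of_nonneg_left (Real.sqrt_le_iff.2 ⟨by positivity, ?_⟩) Real.pi_pos.le
    rw [mul_pow, Real.sq_sqrt hd0.le, mul_comm]
    exact axisDistSq_le_of_mem_hardyCylinder hd hx
  have key := coshSqrt_add_one_le (by positivity) hxy hy
  rw [show (2 * (Real.pi * √(axisDistSq d x))) ^ 2 = 4 * Real.pi ^ 2 * axisDistSq d x by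
    rw [mul_pow, mul_pow, Real.sq_sqrt hq]; ring, ← hT] at key
  rw [laplacian_poleFunction hd, sum_fderiv_poleFunction_sq hd, ← mul_assoc (a + a ^ 2),
    mul_div_cancel_right₀ _ hW.ne']
  have hcos := Real.cos_le_one (2 * Real.pi * coordSum d x)
  generalize deriv coshSqrt (4 * Real.pi ^ 2 * axisDistSq d x) = A at *
  generalize coshSqrt (4 * Real.pi ^ 2 * axisDistSq d x) = C at *
  generalize Real.cos (2 * Real.pi * coordSum d x) = c at *
  have h1 : a ^ 2 * (C + c) ≤ a ^ 2 * (4 * A * T) := by gcongr; linarith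
  have h2 : 2 * a * (d - 2) * A - a ^ 2 * (4 * A * T) = (d - 2) ^ 2 / (4 * T) * A := by
    rw [ha]; field_simp; ring
  have h3 : 4 * Real.pi ^ 2 * d * ((d - 2) ^ 2 / (4 * T) * A)
      ≤ 4 * Real.pi ^ 2 * d * (2 * a * (d - 2) * A - a ^ 2 * (C + c)) := by
    gcongr; linarith
  linarith

/-- For a test function `V u² = 4π²d ψ'(t) u² / W` holds everywhere, as `u` vanishes near the poles;
the right-hand side is continuous. -/
theorem hardyPotential_mul_sq_eq {d : ℕ} (hd : 1 ≤ d) {R : ℝ}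
    {u : EuclideanSpace ℝ (Fin d) → ℝ}
    (hu : IsTestFunction (hardyCylinder d R \ ⋃ k : ℤ, {hardyPole d (1 / d) k}) u)
    (x : EuclideanSpace ℝ (Fin d)) :
    hardyPotential d (1 / d) x * u x ^ 2 =
      4 * Real.pi ^ 2 * d * deriv coshSqrt (4 * Real.pi ^ 2 * axisDistSq d x) *
        (u x ^ 2 / poleFunction d x) := by
  by_cases hx : x ∈ tsupport u
  · rw [hardyPotential_eq hd (hu.2.2 hx).2]; ring
  · simp [image_eq_zero_of_notMem_tsupport hx]

theorem continuous_hardyPotential_mul_sq {d : ℕ} (hd : 1 ≤ d) {R : ℝ}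
    {u : EuclideanSpace ℝ (Fin d) → ℝ}
    (hu : IsTestFunction (hardyCylinder d R \ ⋃ k : ℤ, {hardyPole d (1 / d) k}) u) :
    Continuous fun x => hardyPotential d (1 / d) x * u x ^ 2 := by
  simp_rw [hardyPotential_mul_sq_eq hd hu]
  have h1 : ContDiff ℝ ∞ fun x => u x ^ 2 / poleFunction d x := by
    refine contDiff_div_of_tsupport_subset (hu.1.pow 2) (contDiff_poleFunction d) fun x hx =>
      (poleFunction_pos hd (hu.2.2 (closure_mono ?_ hx)).2).ne'
    intro y hy h0
    simp [h0] at hy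
  have h2 := contDiff_deriv_coshSqrt.continuous
  have h3 := (contDiff_axisDistSq d).continuous
  exact (continuous_const.mul (h2.comp (continuous_const.mul h3))).mul h1.continuous

theorem hasCompactSupport_hardyPotential_mul_sq {d : ℕ}
    {u : EuclideanSpace ℝ (Fin d) → ℝ} (hu : HasCompactSupport u) (h : ℝ) :
    HasCompactSupport fun x => hardyPotential d h x * u x ^ 2 :=
  hu.mono fun x hx h0 => hx (by simp [h0])

theorem setIntegral_hardyPotential_eq {d : ℕ} {R h : ℝ} {u : EuclideanSpace ℝ (Fin d) → ℝ}
    (hu : IsTestFunction (hardyCylinder d R \ ⋃ k : ℤ, {hardyPole d h k}) u) :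
    ∫ x in hardyCylinder d R, hardyPotential d h x * u x ^ 2 =
      ∫ x, hardyPotential d h x * u x ^ 2 :=
  setIntegral_eq_integral_of_forall_compl_eq_zero fun x hx => by
    simp [image_eq_zero_of_notMem_tsupport fun h' => hx (hu.2.2 h').1]

theorem setIntegral_norm_gradient_sq_eq {d : ℕ} {R h : ℝ} {u : EuclideanSpace ℝ (Fin d) → ℝ}
    (hu : IsTestFunction (hardyCylinder d R \ ⋃ k : ℤ, {hardyPole d h k}) u) :
    ∫ x in hardyCylinder d R, ‖gradient u x‖ ^ 2 = ∫ x, ‖gradient u x‖ ^ 2 :=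
  setIntegral_eq_integral_of_forall_compl_eq_zero fun x hx => by
    have : fderiv ℝ u x = 0 := image_eq_zero_of_notMem_tsupport
      fun h' => hx (hu.2.2 (tsupport_fderiv_subset ℝ h')).1
    simp [gradient, this]

theorem hardyPotential_nonneg (d : ℕ) (h : ℝ) (x : EuclideanSpace ℝ (Fin d)) :
    0 ≤ hardyPotential d h x :=
  tsum_nonneg fun k => by positivity

theorem integral_hardyPotential_pos {d : ℕ} (hd : 1 ≤ d) {R : ℝ}
    {u : EuclideanSpace ℝ (Fin d) → ℝ}
    (hu : IsTestFunction (hardyCylinder d R \ ⋃ k : ℤ, {hardyPole d (1 / d) k}) u) (h0 : u ≠ 0) :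
    0 < ∫ x, hardyPotential d (1 / d) x * u x ^ 2 := by
  obtain ⟨x, hx⟩ := Function.ne_iff.1 h0
  refine (continuous_hardyPotential_mul_sq hd hu).integral_pos_of_hasCompactSupport_nonneg_nonzero
    (hasCompactSupport_hardyPotential_mul_sq hu.2.1 _)
    (fun x => mul_nonneg (hardyPotential_nonneg d _ x) (sq_nonneg _)) (x := x) ?_
  have hxt := hu.2.2 (subset_tsupport u hx)
  rw [hardyPotential_eq hd hxt.2]
  have h1 := poleFunction_pos hd hxt.2
  have hq := axisDistSq_nonneg hd x
  have h2 := deriv_coshSqrt_pos (t := 4 * Real.pi ^ 2 * axisDistSq d x) (by positivity)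
  have hx' : u x ≠ 0 := hx
  positivity

/-- The Hardy inequality on the cylinder. -/
theorem hardy_inequality_cylinder {d : ℕ} (hd : 1 ≤ d) {R : ℝ} (hR : 0 < R)
    {u : EuclideanSpace ℝ (Fin d) → ℝ}
    (hu : IsTestFunction (hardyCylinder d R \ ⋃ k : ℤ, {hardyPole d (1 / d) k}) u) :
    ((d : ℝ) - 2) ^ 2 / (4 * (Real.pi * R * √d * realCoth (Real.pi * R * √d))) *
      ∫ x, hardyPotential d (1 / d) x * u x ^ 2 ≤ ∫ x, ‖gradient u x‖ ^ 2 := by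
  obtain ⟨T, hT⟩ : ∃ T, T = Real.pi * R * √d * realCoth (Real.pi * R * √d) := ⟨_, rfl⟩
  rw [← hT, ← integral_const_mul]
  have hTpos : 0 < T := by
    rw [hT]; linarith [one_le_mul_realCoth (y := Real.pi * R * √d) (by positivity)]
  obtain ⟨hI, hle⟩ := integral_weight_le_integral_norm_gradient_sq hu.1 hu.2.1
    (contDiff_poleFunction d) (fun x hx => (poleFunction_pos hd (hu.2.2 hx).2).ne') (((d : ℝ) - 2) / (4 * T))
  refine le_trans (integral_mono_of_nonneg (Eventually.of_forall fun x => ?_) ?_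
    (Eventually.of_forall fun x => ?_)) hle
  · exact mul_nonneg (by positivity) (mul_nonneg (hardyPotential_nonneg d _ x) (sq_nonneg _))
  · exact hI
  · simp only [hardyPotential_mul_sq_eq hd hu, ← mul_assoc]
    by_cases hx : x ∈ tsupport u
    · have hW := poleFunction_pos hd (hu.2.2 hx).2
      refine mul_le_mul_of_nonneg_right ?_ (by positivity)
      have := le_weight_poleFunction hd hR (hu.2.2 hx).1 hW hT rfl
      linarith
    · simp [image_eq_zero_of_notMem_tsupport hx]

/-! ### Functions of `log ‖x‖` -/

section LogRadial

variable {d : ℕ} {h : ℝ → ℝ} {A B : ℝ}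

/-- For `h` supported in `[A, B]` with `B < 0`, the function `x ↦ h (log ‖x‖)` is supported in an
annulus. The sign of `B` excludes the origin, where `log 0 = 0`. -/
theorem tsupport_comp_log_norm_subset (hs : ∀ t, h t ≠ 0 → t ∈ Icc A B) (hB : B < 0) :
    tsupport (fun x : EuclideanSpace ℝ (Fin d) => h (Real.log ‖x‖)) ⊆
      {x | Real.exp A ≤ ‖x‖ ∧ ‖x‖ ≤ Real.exp B} := by
  refine closure_minimal (fun x hx => ?_) ?_
  · have h1 := hs _ hx
    have hx0 : 0 < ‖x‖ := by
      refine (norm_nonneg x).lt_of_ne' fun h0 => ?_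
      rw [h0, Real.log_zero] at h1
      exact absurd h1.2 (not_le.2 hB)
    exact ⟨(Real.le_log_iff_exp_le hx0).1 h1.1, (Real.log_le_iff_le_exp hx0).1 h1.2⟩
  · exact (isClosed_le continuous_const continuous_norm).inter
      (isClosed_le continuous_norm continuous_const)

theorem zero_notMem_tsupport_comp_log_norm (hs : ∀ t, h t ≠ 0 → t ∈ Icc A B) (hB : B < 0) :
    (0 : EuclideanSpace ℝ (Fin d)) ∉
      tsupport (fun x : EuclideanSpace ℝ (Fin d) => h (Real.log ‖x‖)) := fun h0 => by
  have := (tsupport_comp_log_norm_subset hs hB h0).1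
  rw [norm_zero] at this
  exact absurd this (not_le.2 (Real.exp_pos A))

theorem hasCompactSupport_comp_log_norm (hs : ∀ t, h t ≠ 0 → t ∈ Icc A B) (hB : B < 0) :
    HasCompactSupport (fun x : EuclideanSpace ℝ (Fin d) => h (Real.log ‖x‖)) :=
  (isCompact_closedBall (0 : EuclideanSpace ℝ (Fin d)) (Real.exp B)).of_isClosed_subset
    (isClosed_tsupport _) fun x hx => by
      simpa using (tsupport_comp_log_norm_subset hs hB hx).2

theorem contDiff_comp_log_norm (hh : ContDiff ℝ ∞ h) (hs : ∀ t, h t ≠ 0 → t ∈ Icc A B)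
    (hB : B < 0) : ContDiff ℝ ∞ (fun x : EuclideanSpace ℝ (Fin d) => h (Real.log ‖x‖)) := by
  refine contDiff_iff_contDiffAt.2 fun x => ?_
  by_cases hx : x = 0
  · subst hx
    exact (contDiffAt_const (c := (0 : ℝ))).congr_of_eventuallyEq
      (notMem_tsupport_iff_eventuallyEq.1 (zero_notMem_tsupport_comp_log_norm hs hB))
  · exact hh.contDiffAt.comp x ((contDiffAt_norm ℝ hx).log (norm_ne_zero_iff.2 hx))

theorem norm_gradient_comp_log_norm_sq (hh : ContDiff ℝ ∞ h)
    (hs : ∀ t, h t ≠ 0 → t ∈ Icc A B) (hB : B < 0) (x : EuclideanSpace ℝ (Fin d)) :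
    ‖gradient (fun x : EuclideanSpace ℝ (Fin d) => h (Real.log ‖x‖)) x‖ ^ 2 =
      deriv h (Real.log ‖x‖) ^ 2 / ‖x‖ ^ 2 := by
  by_cases hx : x = 0
  · subst hx
    have : fderiv ℝ (fun x : EuclideanSpace ℝ (Fin d) => h (Real.log ‖x‖)) 0 = 0 :=
      image_eq_zero_of_notMem_tsupport fun h' =>
        zero_notMem_tsupport_comp_log_norm hs hB (tsupport_fderiv_subset ℝ h')
    simp [gradient, this]
  · have hx0 : ‖x‖ ≠ 0 := norm_ne_zero_iff.2 hx
    have h1 : HasFDerivAt (fun y : EuclideanSpace ℝ (Fin d) => Real.log ‖y‖)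
        ((‖x‖ ^ 2)⁻¹ • innerSL ℝ x) x := by
      have h2 := ((hasStrictFDerivAt_norm_sq x).hasFDerivAt.log (pow_ne_zero 2 hx0)).const_mul
        (1 / 2 : ℝ)
      have h3 : (fun y : EuclideanSpace ℝ (Fin d) => 1 / 2 * Real.log (‖y‖ ^ 2))
          = fun y => Real.log ‖y‖ := by
        ext y; rw [Real.log_pow]; push_cast; ring
      rw [h3] at h2
      refine h2.congr_fderiv ?_
      ext y
      simp
      ring
    have h2 : HasFDerivAt (fun x : EuclideanSpace ℝ (Fin d) => h (Real.log ‖x‖)) _ x :=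
      ((hh.differentiable (by simp)) _).hasDerivAt.comp_hasFDerivAt x h1
    rw [gradient, LinearIsometryEquiv.norm_map, h2.fderiv, norm_smul, norm_smul, innerSL_apply_norm,
      norm_inv, norm_pow, norm_norm, mul_pow, mul_pow, Real.norm_eq_abs, sq_abs]
    field_simp

/-- Polar coordinates followed by the substitution `‖x‖ = eᵗ`. -/
theorem integral_comp_log_norm_div_norm_sq (hd : 1 ≤ d) (f : ℝ → ℝ) :
    ∫ x : EuclideanSpace ℝ (Fin d), f (Real.log ‖x‖) / ‖x‖ ^ 2 =
      d * volume.real (Metric.ball (0 : EuclideanSpace ℝ (Fin d)) 1) *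
        ∫ t, Real.exp ((d - 2) * t) * f t := by
  have : Nontrivial (EuclideanSpace ℝ (Fin d)) := by
    have : Nonempty (Fin d) := ⟨⟨0, hd⟩⟩
    infer_instance
  rw [integral_fun_norm_addHaar volume (fun r => f (Real.log r) / r ^ 2)]
  simp only [finrank_euclideanSpace_fin, nsmul_eq_mul, smul_eq_mul, ← mul_assoc]
  congr 1
  rw [← Real.range_exp, ← image_univ, integral_image_eq_integral_abs_deriv_smul MeasurableSet.univ
    (fun x _ => (Real.hasDerivAt_exp x).hasDerivWithinAt) Real.exp_injective.injOn]
  simp only [Measure.restrict_univ, Real.log_exp, smul_eq_mul]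
  refine integral_congr_ae (Eventually.of_forall fun t => ?_)
  have e1 : Real.exp t * Real.exp t ^ (d - 1) = Real.exp (d * t) := by
    rw [← pow_succ', Nat.sub_add_cancel hd, ← Real.exp_nat_mul]
  have e2 : Real.exp ((d - 2) * t) = Real.exp (d * t) / Real.exp t ^ 2 := by
    rw [← Real.exp_nat_mul, ← Real.exp_sub]
    congr 1
    push_cast
    ring
  simp only [abs_of_pos (Real.exp_pos t), e2]
  rw [← e1]
  ring

end LogRadial

/-! ### The upper bound by concentration at one pole -/

/-- The annulus `e^A ≤ ‖x‖ ≤ e^B` around the pole `0` contains no pole and lies in the cylinder as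
soon as `e^B < min R (1/d)`. -/
theorem annulus_subset {d : ℕ} (hd : 1 ≤ d) {R A B : ℝ} (hR : Real.exp B < R)
    (hB : Real.exp B < 1 / d) :
    {x : EuclideanSpace ℝ (Fin d) | Real.exp A ≤ ‖x‖ ∧ ‖x‖ ≤ Real.exp B} ⊆
      hardyCylinder d R \ ⋃ k : ℤ, {hardyPole d (1 / d) k} := by
  rintro x ⟨hxA, hxB⟩
  refine ⟨?_, fun hx => ?_⟩
  · have h0 : (0 : EuclideanSpace ℝ (Fin d)) ∈ diagonalAxis d := ⟨0, fun i => rfl⟩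
    calc Metric.infDist x (diagonalAxis d) ≤ dist x 0 := Metric.infDist_le_dist_of_mem h0
      _ = ‖x‖ := dist_zero_right x
      _ < R := hxB.trans_lt hR
  · obtain ⟨k, hk⟩ := mem_iUnion.1 hx
    rw [mem_singleton_iff] at hk
    have hd0 : (0 : ℝ) < d := by positivity
    rcases eq_or_ne k 0 with rfl | hk0
    · have : x = 0 := by rw [hk]; ext i; simp [hardyPole]
      rw [this, norm_zero] at hxA
      exact absurd hxA (not_le.2 (Real.exp_pos A))
    · have h1 := PiLp.norm_apply_le x (⟨0, hd⟩ : Fin d)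
      have h2 : ‖x ⟨0, hd⟩‖ = |(k : ℝ)| * (1 / d) := by
        rw [hk, Real.norm_eq_abs]
        simp [hardyPole, abs_mul]
      have h3 : (1 : ℝ) ≤ |(k : ℝ)| := by exact_mod_cast Int.one_le_abs hk0
      have h4 : 1 / (d : ℝ) ≤ |(k : ℝ)| * (1 / d) := le_mul_of_one_le_left (by positivity) h3
      linarith

/-- `V` dominates the potential of the single pole at the origin. -/
theorem integral_sq_div_norm_sq_le {d : ℕ} (hd : 1 ≤ d) {R : ℝ}
    {u : EuclideanSpace ℝ (Fin d) → ℝ}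
    (hu : IsTestFunction (hardyCylinder d R \ ⋃ k : ℤ, {hardyPole d (1 / d) k}) u) :
    ∫ x, u x ^ 2 / ‖x‖ ^ 2 ≤ ∫ x, hardyPotential d (1 / d) x * u x ^ 2 := by
  refine integral_mono_of_nonneg (Eventually.of_forall fun x => by positivity)
    ((continuous_hardyPotential_mul_sq hd hu).integrable_of_hasCompactSupport
      (hasCompactSupport_hardyPotential_mul_sq hu.2.1 _)) (Eventually.of_forall fun x => ?_)
  by_cases hx : x ∈ tsupport u
  · have h1 := le_hasSum (hasSum_hardyPotential hd (hu.2.2 hx).2) 0 (fun k _ => by positivity)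
    rw [← hardyPotential_eq hd (hu.2.2 hx).2] at h1
    have h0 : hardyPole d (1 / d) 0 = 0 := by ext i; simp [hardyPole]
    rw [h0, sub_zero] at h1
    have := mul_le_mul_of_nonneg_right h1 (sq_nonneg (u x))
    calc u x ^ 2 / ‖x‖ ^ 2 = 1 / ‖x‖ ^ 2 * u x ^ 2 := by ring
      _ ≤ _ := this
  · simp [image_eq_zero_of_notMem_tsupport hx]

/-- In one dimension, `∫ (g' + κ g)² = ∫ g'² + κ² ∫ g²`, as `2 g g'` is a derivative. -/
theorem integral_deriv_add_mul_sq {g : ℝ → ℝ} (hg : ContDiff ℝ ∞ g) (hc : HasCompactSupport g)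
    (κ : ℝ) : ∫ t, (deriv g t + κ * g t) ^ 2 = (∫ t, deriv g t ^ 2) + κ ^ 2 * ∫ t, g t ^ 2 := by
  have hg' : ContDiff ℝ ∞ (deriv g) := (contDiff_infty_iff_deriv.1 hg).2
  have i1 : Integrable fun t => deriv g t ^ 2 :=
    (hg'.continuous.pow 2).integrable_of_hasCompactSupport
      (by simpa only [pow_two] using hc.deriv.mul_left)
  have i2 : Integrable fun t => g t ^ 2 :=
    (hg.continuous.pow 2).integrable_of_hasCompactSupport
      (by simpa only [pow_two] using hc.mul_left)
  have i3 : Integrable fun t => 2 * g t * deriv g t :=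
    ((continuous_const.mul hg.continuous).mul hg'.continuous).integrable_of_hasCompactSupport
      hc.deriv.mul_left
  have h0 : ∫ t, 2 * g t * deriv g t = 0 := by
    refine integral_eq_zero_of_hasDerivAt_of_integrable (f := fun t => g t ^ 2) (fun t => ?_) i3 i2
    have h : HasDerivAt (fun t => g t ^ 2) _ t :=
      ((hg.differentiable (by simp)) t).hasDerivAt.pow 2
    exact h.congr_deriv (by simp)
  have : ∀ t, (deriv g t + κ * g t) ^ 2
      = deriv g t ^ 2 + κ * (2 * g t * deriv g t) + κ ^ 2 * g t ^ 2 := fun t => by ring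
  have i4 : Integrable fun t => deriv g t ^ 2 + κ * (2 * g t * deriv g t) := i1.add (i3.const_mul _)
  simp_rw [this]
  rw [integral_add i4 (i2.const_mul _), integral_add i1 (i3.const_mul _), integral_const_mul,
    integral_const_mul, h0]
  ring

theorem bddBelow_hardyQuotients (d : ℕ) (h R : ℝ) : BddBelow (hardyQuotients d h R) := by
  refine ⟨0, ?_⟩
  rintro q ⟨u, -, -, rfl⟩
  exact div_nonneg (integral_nonneg fun x => by positivity)
    (integral_nonneg fun x => mul_nonneg (hardyPotential_nonneg d h x) (sq_nonneg _))

/-- A one-dimensional profile `g`, used as `u(x) = ‖x‖^κ g (log ‖x‖)` with `κ = -(d-2)/2`,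
gives a test function whose quotient is at most `κ² + ∫ g'² / ∫ g²`. -/
theorem exists_hardyQuotient_le {d : ℕ} (hd : 1 ≤ d) {R A B : ℝ} (hR : Real.exp B < R)
    (hBd : Real.exp B < 1 / d) (hB : B < 0) {g : ℝ → ℝ} (hg : ContDiff ℝ ∞ g)
    (hs : ∀ t, g t ≠ 0 → t ∈ Icc A B) (hpos : 0 < ∫ t, g t ^ 2) :
    ∃ q ∈ hardyQuotients d (1 / d) R,
      q ≤ (∫ t, deriv g t ^ 2) / (∫ t, g t ^ 2) + ((d : ℝ) - 2) ^ 2 / 4 := by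
  have hc : HasCompactSupport g :=
    isCompact_Icc.of_isClosed_subset (isClosed_tsupport _) (closure_minimal hs isClosed_Icc)
  set κ : ℝ := -((d : ℝ) - 2) / 2 with hκ
  set h : ℝ → ℝ := fun t => g t * Real.exp (κ * t) with hh
  have hh1 : ContDiff ℝ ∞ h := hg.mul (Real.contDiff_exp.comp (contDiff_const.mul contDiff_id))
  have hh2 : ∀ t, h t ≠ 0 → t ∈ Icc A B := fun t ht => hs t (left_ne_zero_of_mul ht)
  have hh3 : ∀ t, deriv h t = (deriv g t + κ * g t) * Real.exp (κ * t) := fun t => by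
    have h1 : HasDerivAt (fun t => Real.exp (κ * t)) (Real.exp (κ * t) * (κ * 1)) t :=
      ((hasDerivAt_id t).const_mul κ).exp
    have h2 : HasDerivAt h _ t := ((hg.differentiable (by simp)) t).hasDerivAt.mul h1
    rw [h2.deriv]
    ring
  have hexp : ∀ t, Real.exp ((d - 2) * t) * Real.exp (κ * t) ^ 2 = 1 := fun t => by
    rw [← Real.exp_nat_mul, ← Real.exp_add, Real.exp_eq_one_iff, hκ]
    push_cast
    ring
  set u : EuclideanSpace ℝ (Fin d) → ℝ := fun x => h (Real.log ‖x‖) with hu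
  set σ : ℝ := d * volume.real (Metric.ball (0 : EuclideanSpace ℝ (Fin d)) 1) with hσ
  have hσ0 : 0 < σ := mul_pos (by positivity)
    (ENNReal.toReal_pos (Metric.measure_ball_pos _ _ one_pos).ne' measure_ball_lt_top.ne)
  have hut : IsTestFunction (hardyCylinder d R \ ⋃ k : ℤ, {hardyPole d (1 / d) k}) u :=
    ⟨contDiff_comp_log_norm hh1 hh2 hB, hasCompactSupport_comp_log_norm hh2 hB,
      (tsupport_comp_log_norm_subset hh2 hB).trans (annulus_subset hd hR hBd)⟩
  have hgrad : ∫ x, ‖gradient u x‖ ^ 2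
      = σ * ((∫ t, deriv g t ^ 2) + κ ^ 2 * ∫ t, g t ^ 2) := by
    simp_rw [hu, norm_gradient_comp_log_norm_sq hh1 hh2 hB]
    rw [integral_comp_log_norm_div_norm_sq hd (fun t => deriv h t ^ 2),
      ← integral_deriv_add_mul_sq hg hc]
    congr 1
    refine integral_congr_ae (Eventually.of_forall fun t => ?_)
    simp only [hh3]
    linear_combination (deriv g t + κ * g t) ^ 2 * hexp t
  have hmass : ∫ x, u x ^ 2 / ‖x‖ ^ 2 = σ * ∫ t, g t ^ 2 := by
    rw [integral_comp_log_norm_div_norm_sq hd (fun t => h t ^ 2)]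
    congr 1
    refine integral_congr_ae (Eventually.of_forall fun t => ?_)
    simp only [hh]
    linear_combination g t ^ 2 * hexp t
  have hle := integral_sq_div_norm_sq_le hd hut
  rw [hmass] at hle
  refine ⟨_, ⟨u, hut, ?_, rfl⟩, ?_⟩
  · rintro h0
    rw [h0] at hmass
    simp only [Pi.zero_apply, ne_eq, OfNat.ofNat_ne_zero, not_false_eq_true, zero_pow, zero_div,
      integral_zero] at hmass
    exact (mul_pos hσ0 hpos).ne hmass
  · rw [setIntegral_norm_gradient_sq_eq hut, setIntegral_hardyPotential_eq hut]
    calc _ ≤ (∫ x, ‖gradient u x‖ ^ 2) / (σ * ∫ t, g t ^ 2) := by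
          gcongr
      _ = _ := by
          rw [hgrad, mul_div_mul_left _ _ hσ0.ne', add_div, mul_div_cancel_right₀ _ hpos.ne', hκ]
          ring

theorem exists_hardyQuotient_lt {d : ℕ} (hd : 1 ≤ d) {R : ℝ} (hR : 0 < R) {c : ℝ}
    (hc : ((d : ℝ) - 2) ^ 2 / 4 < c) : ∃ q ∈ hardyQuotients d (1 / d) R, q < c := by
  have hd0 : (0 : ℝ) < d := by positivity
  obtain ⟨φ, hφ, hφs, hφpos⟩ : ∃ φ : ℝ → ℝ, ContDiff ℝ ∞ φ ∧
      (∀ t, φ t ≠ 0 → t ∈ Icc (-3 : ℝ) (-1)) ∧ 0 < ∫ t, φ t ^ 2 := by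
    let φ : ContDiffBump (-2 : ℝ) := ⟨1 / 2, 1, by norm_num, by norm_num⟩
    refine ⟨φ, φ.contDiff, fun t ht => ?_, ?_⟩
    · have h1 : t ∈ Metric.ball (-2 : ℝ) 1 := by
        rw [show (1 : ℝ) = φ.rOut from rfl, ← φ.support_eq]; exact ht
      rw [Real.ball_eq_Ioo] at h1
      constructor <;> linarith [h1.1, h1.2]
    · refine (φ.continuous.pow 2).integral_pos_of_hasCompactSupport_nonneg_nonzero
        (φ.hasCompactSupport.mono fun t ht h0 => ht (by simp [h0])) (fun t => sq_nonneg _)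
        (x := -2) ?_
      rw [φ.one_of_mem_closedBall (Metric.mem_closedBall_self (by norm_num [φ]))]
      norm_num
  -- stretching `φ` by `n` makes the quotient `∫ g'² / ∫ g²` of order `1 / n²`
  have key : ∀ᶠ n : ℝ in atTop, ∃ q ∈ hardyQuotients d (1 / d) R, q ≤
      n⁻¹ ^ 2 * ((∫ t, deriv φ t ^ 2) / ∫ t, φ t ^ 2) + ((d : ℝ) - 2) ^ 2 / 4 := by
    have hexp : Tendsto (fun n : ℝ => Real.exp (-n)) atTop (𝓝 0) :=
      Real.tendsto_exp_neg_atTop_nhds_zero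
    filter_upwards [hexp.eventually_lt_const hR,
      hexp.eventually_lt_const (one_div_pos.2 hd0), eventually_gt_atTop 0] with n hn1 hn2 hn0
    have hs : ∀ t, φ (t / n) ≠ 0 → t ∈ Icc (-3 * n) (-n) := fun t ht => by
      have h1 := hφs _ ht
      rw [mem_Icc, le_div_iff₀ hn0, div_le_iff₀ hn0] at h1
      exact ⟨h1.1, by linarith [h1.2]⟩
    have hsq : ∫ t, φ (t / n) ^ 2 = n * ∫ t, φ t ^ 2 := by
      rw [Measure.integral_comp_div (fun t => φ t ^ 2) n, abs_of_pos hn0, smul_eq_mul]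
    have hder : ∀ t, deriv (fun t => φ (t / n)) t = n⁻¹ * deriv φ (t / n) := fun t => by
      have h1 : HasDerivAt (fun t : ℝ => t / n) (1 / n) t := (hasDerivAt_id t).div_const n
      have h2 : HasDerivAt (fun t : ℝ => φ (t / n)) _ t :=
        ((hφ.differentiable (by simp)) (t / n)).hasDerivAt.comp t h1
      rw [h2.deriv]
      ring
    have hdsq : ∫ t, deriv (fun t => φ (t / n)) t ^ 2 = n⁻¹ ^ 2 * (n * ∫ t, deriv φ t ^ 2) := by
      simp_rw [hder, mul_pow]
      rw [integral_const_mul, Measure.integral_comp_div (fun t => deriv φ t ^ 2) n,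
        abs_of_pos hn0, smul_eq_mul]
    obtain ⟨q, hq, hle⟩ := exists_hardyQuotient_le hd hn1 hn2 (neg_lt_zero.2 hn0)
      (hφ.comp (contDiff_id.div_const n)) hs (by
        change 0 < ∫ t, φ (t / n) ^ 2
        rw [hsq]; positivity)
    refine ⟨q, hq, hle.trans_eq ?_⟩
    change (∫ t, deriv (fun t => φ (t / n)) t ^ 2) / (∫ t, φ (t / n) ^ 2) + _ = _
    rw [hsq, hdsq]
    field_simp
  have : Tendsto (fun n : ℝ => n⁻¹ ^ 2 * ((∫ t, deriv φ t ^ 2) / ∫ t, φ t ^ 2)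
      + ((d : ℝ) - 2) ^ 2 / 4) atTop
      (𝓝 (0 ^ 2 * ((∫ t, deriv φ t ^ 2) / ∫ t, φ t ^ 2) + ((d : ℝ) - 2) ^ 2 / 4)) :=
    ((tendsto_inv_atTop_zero.pow 2).mul_const _).add_const _
  rw [zero_pow two_ne_zero, zero_mul, zero_add] at this
  obtain ⟨n, ⟨q, hq, hle⟩, hlt⟩ := (key.and (this.eventually_lt_const hc)).exists
  exact ⟨q, hq, hle.trans_lt hlt⟩

theorem hardyConstant_le {d : ℕ} (hd : 1 ≤ d) {R : ℝ} (hR : 0 < R) :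
    hardyConstant d (1 / d) R ≤ ((d : ℝ) - 2) ^ 2 / 4 := by
  refine le_of_forall_gt_imp_ge_of_dense fun c hc => ?_
  obtain ⟨q, hq, hlt⟩ := exists_hardyQuotient_lt hd hR hc
  exact (csInf_le (bddBelow_hardyQuotients d _ R) hq).trans hlt.le

theorem le_hardyConstant {d : ℕ} (hd : 1 ≤ d) {R : ℝ} (hR : 0 < R) :
    ((d : ℝ) - 2) ^ 2 / (4 * (Real.pi * R * √d * realCoth (Real.pi * R * √d))) ≤
      hardyConstant d (1 / d) R := by
  obtain ⟨q, hq, -⟩ := exists_hardyQuotient_lt hd hR (lt_add_one _)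
  refine le_csInf ⟨q, hq⟩ ?_
  rintro _ ⟨u, hu, hu0, rfl⟩
  rw [setIntegral_norm_gradient_sq_eq hu, setIntegral_hardyPotential_eq hu,
    le_div_iff₀ (integral_hardyPotential_pos hd hu hu0)]
  exact hardy_inequality_cylinder hd hR hu

end

/-! ### The Hardy constant of the cylinder -/

theorem theorem2 (d : ℕ) (hd : 1 ≤ d) :
    (∀ R : ℝ, 0 < R →
      ((d : ℝ) - 2) ^ 2 /
          (4 * Real.pi * R * Real.sqrt (d : ℝ) * realCoth (Real.pi * R * Real.sqrt (d : ℝ)))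
        ≤ hardyConstant d (1 / (d : ℝ)) R ∧
      hardyConstant d (1 / (d : ℝ)) R ≤ ((d : ℝ) - 2) ^ 2 / 4) ∧
    Tendsto (fun R : ℝ => hardyConstant d (1 / (d : ℝ)) R) (𝓝[>] 0)
      (𝓝 (((d : ℝ) - 2) ^ 2 / 4)) := by
  have hd0 : (0 : ℝ) < d := by positivity
  refine ⟨fun R hR => ⟨?_, hardyConstant_le hd hR⟩, ?_⟩
  · have h := le_hardyConstant hd hR
    simp only [← mul_assoc] at h
    exact h
  · have h1 : Tendsto (fun R : ℝ => Real.pi * R * √d) (𝓝[>] 0) (𝓝[>] 0) := by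
      refine tendsto_nhdsWithin_iff.2 ⟨?_, ?_⟩
      · have : Continuous fun R : ℝ => Real.pi * R * √d := by fun_prop
        simpa using (this.tendsto 0).mono_left (nhdsWithin_le_nhds (s := Ioi 0))
      · filter_upwards [self_mem_nhdsWithin] with R hR
        have hR : 0 < R := hR
        exact mem_Ioi.2 (by positivity)
    have h2 := tendsto_mul_realCoth.comp h1
    have h3 : Tendsto (fun R : ℝ => ((d : ℝ) - 2) ^ 2 /
        (4 * (Real.pi * R * √d * realCoth (Real.pi * R * √d)))) (𝓝[>] 0)
        (𝓝 (((d : ℝ) - 2) ^ 2 / (4 * 1))) :=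
      tendsto_const_nhds.div (h2.const_mul 4) (by norm_num)
    rw [mul_one] at h3
    refine tendsto_of_tendsto_of_tendsto_of_le_of_le' h3 tendsto_const_nhds ?_ ?_
    · filter_upwards [self_mem_nhdsWithin] with R hR using le_hardyConstant hd hR
    · filter_upwards [self_mem_nhdsWithin] with R hR using hardyConstant_le hd hR
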